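/- Let $\Omega=\{0,1\}^{\infty}$ and let $S$ be the set of finite binary strings. For $x\in S$ let $\Delta(x)\subseteq\Omega$ be the set of infinite sequences that begin with $x$. A probability $P$ on $\Omega\times\Omega$ is computable if some computable $A:S\times S\times\mathbb N\to\mathbb Q$ satisfies $|P(\Delta(x)\times\Delta(y))-A(x,y,k)|<\frac1{k+1}$ for all $x,y,k$; computable probabilities on $\Omega$ are defined in the same way. For a probability $Q$ on $\Omega$, computable or not, a test is a recursively enumerable set $U\subseteq S\times\mathbb N$ such that the sets $\tilde U_n=\bigcup_{(x,n)\in U}\Delta(x)$ satisfy $\tilde U_{n+1}\subseteq\tilde U_n$ and $Q(\tilde U_n)<2^{-n}$ for all $n$. The set $\mathcal R^{Q}$ of $Q$-random (Martin-Löf random) sequences is the complement of the union of the sets $\bigcap_n\tilde U_n$ over all tests $U$. For a probability $P$ on $\Omega\times\Omega$, the set $\mathcal R^{P}\subseteq\Omega\times\Omega$ is defined in the same way, with the sets $\Delta(x)\times\Delta(y)$ in place of $\Delta(x)$. Let $P_X$ and $P_Y$ be the first and the second marginal of $P$, let $\mathcal R^P_{y^\infty}=\{x^\infty\in\Omega :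 (x^\infty,y^\infty)\in\mathcal R^P\}$, and for $y\in S$ with $P_Y(\Delta(y))>0$ let $P(\cdot\mid y)=P(\,\cdot\times\Delta(y))/P_Y(\Delta(y))$, a probability on $\Omega$. For $y^\infty\in\Omega$ let $P(\cdot\mid y^\infty)$ be the probability on $\Omega$, if it exists, such that $P(\Delta(x)\mid y^\infty)=\lim_{y\to y^\infty}P(\Delta(x)\mid y)$ for all $x\in S$, where $y$ runs through the initial segments of $y^\infty$. There is a probability $P$ on $\Omega\times\Omega$, for which $P(\cdot\mid y^\infty)$ exists at every $y^\infty\in\mathcal R^{P_Y}$, such that (1) $P$ is computable, and $1^\infty\in\mathcal R^{P_Y}$, where $1^\infty=111\cdots$; (2) $P(\cdot\mid 1^\infty)$ is not computable; (3) $P(\cdot\mid y)$ and $P(\cdot\mid z)$ are mutually singular for all $y,z\in S$ such that $\Delta(y)\cap\Delta(z)=\emptyset$ (and $P_Y(\Delta(y)),P_Y(\Delta(z))>0$); (4) $\mathcal R^{P(\cdot\mid 1^\infty)}\subsetneq\mathcal R^P_{1^\infty}$; (5) $\bigcup_{y^\infty\in\mathcal R^{P_Y}}\mathcal R^{P(\cdot\mid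 y^\infty)}\subsetneq\mathcal R^{P_X}$; (6) there is $x^\infty\in\mathcal R^{P_X}$ such that $x^\infty\notin\mathcal R^{P(\cdot\mid y^\infty)}$ for every $y^\infty\in\mathcal R^{P_Y}$. -/

import Mathlib

open MeasureTheory Filter Topology
open scoped ENNReal

namespace MLCond

noncomputable section

/-- The space `Ω` of infinite binary sequences, with the product `σ`-algebra (which is the
one generated by the cylinders). -/
abbrev Seq : Type := ℕ → Bool

/-- The set `S` of finite binary strings. -/
abbrev Str : Type := List Bool

/-- The cylinder `Δ(x)`: all infinite sequences that begin with the string `x`. -/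
def cyl (x : Str) : Set Seq :=
  {ω | ∀ (i : ℕ) (hi : i < x.length), ω i = x[i]}

/-- The product cylinder `Δ(x) × Δ(y)` in `Ω × Ω`. -/
def cyl₂ (p : Str × Str) : Set (Seq × Seq) :=
  cyl p.1 ×ˢ cyl p.2

/-- The string of the first `n` terms of the sequence `ω`. -/
def initSeg (ω : Seq) (n : ℕ) : Str :=
  (List.range n).map ω

/-- The constant sequence `1^∞`. -/
def ones : Seq := fun _ => true

section Randomness

variable {ι T : Type} [Primcodable ι] [MeasurableSpace T]

/-- A measure `μ` on `T` is computable, relative to the basic sets `Δ i`, if there is a computable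
function of `i` and `k` with rational values (written here as `(a - b) / (c + 1)` with computable
natural numbers `a`, `b`, `c`) that approximates `μ (Δ i)` with error less than `1 / (k + 1)`. -/
def IsComputable (Δ : ι → Set T) (μ : Measure T) : Prop :=
  ∃ a b c : ι × ℕ → ℕ, Computable a ∧ Computable b ∧ Computable c ∧
    ∀ (i : ι) (k : ℕ),
      |μ.real (Δ i) - ((a (i, k) : ℝ) - (b (i, k) : ℝ)) / ((c (i, k) : ℝ) + 1)|
        < 1 / ((k : ℝ) + 1)

/-- The `n`-th open set of `U ⊆ ι × ℕ`: the union of the basic sets `Δ i` with `(i, n) ∈ U`. -/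
def level (Δ : ι → Set T) (U : Set (ι × ℕ)) (n : ℕ) : Set T :=
  {t | ∃ i, (i, n) ∈ U ∧ t ∈ Δ i}

/-- `U` is a (Martin-Löf) test with respect to `μ`: it is recursively enumerable, its levels
decrease, and the `n`-th level has measure less than `2⁻ⁿ`. The measure `μ` need not be
computable. -/
def IsTest (Δ : ι → Set T) (μ : Measure T) (U : Set (ι × ℕ)) : Prop :=
  REPred (fun p : ι × ℕ => p ∈ U) ∧
    ∀ n, level Δ U (n + 1) ⊆ level Δ U n ∧ μ (level Δ U n) < (2⁻¹ : ℝ≥0∞) ^ n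

/-- The set of Martin-Löf random points with respect to `μ`: the complement of the union, over all
tests, of the intersection of their levels. -/
def mlRandom (Δ : ι → Set T) (μ : Measure T) : Set T :=
  (⋃ (U : Set (ι × ℕ)) (_ : IsTest Δ μ U), ⋂ n, level Δ U n)ᶜ

end Randomness

/-- The section `R^P_{y^∞} = {x^∞ | (x^∞, y^∞) ∈ R^P}` of the random set of `P`. -/
def randomSection (P : Measure (Seq × Seq)) (η : Seq) : Set Seq :=
  {ξ | (ξ, η) ∈ mlRandom cyl₂ P}

/-- The conditional probability `P(· | y)` on the first coordinate, given that the second coordinate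
lies in `Δ(y)`. It is the zero measure if `Δ(y)` has probability zero. -/
def condStr (P : Measure (Seq × Seq)) (y : Str) : Measure Seq :=
  (ProbabilityTheory.cond P (Prod.snd ⁻¹' cyl y)).fst

/-- `ν` is the conditional probability `P(· | y^∞)`: a probability measure with
`ν (Δ(x)) = lim_{y → y^∞} P(x | y)` for all strings `x`, where `y` runs through the initial segments
of `y^∞`. Its values on cylinders determine `ν`, so that there is at most one. -/
def IsCondAt (P : Measure (Seq × Seq)) (η : Seq) (ν : Measure Seq) : Prop :=
  IsProbabilityMeasure ν ∧
    ∀ x : Str, Tendsto (fun n => condStr P (initSeg η n) (cyl x)) atTop (𝓝 (ν (cyl x)))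

open Classical in
/-- The conditional probability `P(· | y^∞)` where it exists (and the zero measure elsewhere). -/
def condAt (P : Measure (Seq × Seq)) (η : Seq) : Measure Seq :=
  if h : ∃ ν, IsCondAt P η ν then h.choose else 0

end

end MLCond

open MLCond

/-! Let `ξ` be a Martin-Löf random sequence for the uniform measure which is the limit from below of
a computable, lexicographically increasing sequence of strings with values `h n`. Draw `ω` uniformly
and let the second coordinate record, for each `i`, whether the `i`-th initial segment of `ω` is
still at least `h i`. This record is a run of ones followed by zeros, and it equals `1^∞` exactly
when `ω ≥ ξ`. The joint law is computable because `h` is, and its first marginal is uniform. Since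
`ξ` has zeros arbitrarily far out, `ω ≥ ξ` has positive probability, so `1^∞` is an atom of the
second marginal. All random parameters are atoms, which makes the conditional probabilities ordinary
conditioning.

Given `1^∞`, the first coordinate is uniform on `[ξ, 1^∞]`. Strings not exceeding `ξ` can be
enumerated; if this conditional law were computable, strings of positive mass could be enumerated
too, and the two together would list the initial segments of `ξ`, contradicting randomness
(`not_isComputable_condPoint`). The same enumeration gives a test for the conditional law that
catches `ξ`, as the mass below `ξ` is gone (`notMem_mlRandom_condPoint_ones`). For any other
parameter a neighbourhood of `ξ` has conditional mass zero. Yet `(ξ, 1^∞)` is the image of `ξ` under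
the computable graph map and hence random for the joint law (`mem_randomSection_ones`). So `ξ` alone
separates the sets in (4), (5) and (6). The inclusions hold because conditioning on an atom costs
only a constant factor, and mutual singularity because the second coordinate is a function of the
first. -/

namespace MLCond

/-! ### Recursively enumerable predicates -/

section RE

variable {α β : Type} [Primcodable α] [Primcodable β]

open Encodable Nat.Partrec in
/-- Membership in a recursively enumerable set, decided in `k` steps of a program. -/
theorem exists_code_of_rePred {p : α → Prop} (hp : REPred p) :
    ∃ c : Code, ∀ a, p a ↔ ∃ k, (c.evaln k (encode a)).isSome := by
  obtain ⟨c, hc⟩ := Code.exists_code.1 hp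
  refine ⟨c, fun a => ?_⟩
  have h1 : p a ↔ (c.eval (encode a)).Dom := by
    rw [hc]
    simp [Part.assert, Part.bind]
  rw [h1, Part.dom_iff_mem]
  simp only [Code.evaln_complete, Option.isSome_iff_exists, Option.mem_def]
  exact exists_comm

-- Step-bounded evaluation is primitive recursive, so enumerable predicates can be handled as
-- existential quantifiers over primitive recursive ones.
open Encodable Nat.Partrec in
theorem exists_primrec_of_rePred {p : α → Prop} (hp : REPred p) :
    ∃ q : α × ℕ → Bool, Primrec q ∧ ∀ a, p a ↔ ∃ k, q (a, k) = true := by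
  obtain ⟨c, hc⟩ := exists_code_of_rePred hp
  refine ⟨fun z => (c.evaln z.2 (encode z.1)).isSome, ?_, hc⟩
  exact Primrec.option_isSome.comp (Code.primrec_evaln.comp
    ((Primrec.snd.pair (Primrec.const c)).pair (Primrec.encode.comp Primrec.fst)))

theorem rePred_of_computable {q : α × ℕ → Bool} (hq : Computable q) :
    REPred fun a => ∃ k, q (a, k) = true := by
  have h : Partrec fun a => Nat.rfind fun k => (Part.some (q (a, k)) : Part Bool) :=
    Partrec.rfind (p := fun a k => (Part.some (q (a, k)) : Part Bool)) hq.partrec.to₂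
  refine (Partrec.dom_re h).of_eq fun a => ?_
  refine Nat.rfind_dom'.trans (exists_congr fun k => ?_)
  exact ⟨fun h => (Part.mem_some_iff.1 h.1).symm,
    fun h => ⟨Part.mem_some_iff.2 h.symm, fun _ => trivial⟩⟩

theorem rePred_exists {p : α × β → Prop} (hp : REPred p) : REPred fun a => ∃ b, p (a, b) := by
  obtain ⟨q, hq, hpq⟩ := exists_primrec_of_rePred hp
  -- One search variable codes both the witness and the step bound.
  have h : Primrec fun z : α × ℕ => ((Encodable.decode (α := β × ℕ) z.2).map
      fun w => q ((z.1, w.1), w.2)).getD false := by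
    refine Primrec.option_getD.comp (Primrec.option_map (Primrec.decode.comp Primrec.snd) ?_)
      (Primrec.const false)
    exact hq.comp (((Primrec.fst.comp Primrec.fst).pair (Primrec.fst.comp Primrec.snd)).pair
      (Primrec.snd.comp Primrec.snd))
  refine (rePred_of_computable h.to_comp).of_eq fun a => ?_
  constructor
  · rintro ⟨k, hk⟩
    rcases hd : (Encodable.decode (α := β × ℕ) k) with _ | w
    · simp [hd] at hk
    · simp only [hd, Option.map_some, Option.getD_some] at hk
      exact ⟨w.1, (hpq _).2 ⟨w.2, hk⟩⟩
  · rintro ⟨b, hb⟩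
    obtain ⟨k, hk⟩ := (hpq _).1 hb
    exact ⟨Encodable.encode (b, k), by simp [hk]⟩

theorem rePred_comp {p : β → Prop} (hp : REPred p) {f : α → β} (hf : Computable f) :
    REPred fun a => p (f a) :=
  Partrec.comp hp hf

theorem rePred_and {p q : α → Prop} (hp : REPred p) (hq : REPred q) :
    REPred fun a => p a ∧ q a := by
  obtain ⟨f, hf, hpf⟩ := exists_primrec_of_rePred hp
  obtain ⟨g, hg, hqg⟩ := exists_primrec_of_rePred hq
  have h : Primrec fun z : (α × ℕ) × ℕ => (f z.1 && g (z.1.1, z.2)) :=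
    Primrec.and.comp (hf.comp Primrec.fst)
      (hg.comp ((Primrec.fst.comp Primrec.fst).pair Primrec.snd))
  refine (rePred_exists (rePred_of_computable h.to_comp)).of_eq fun a => ?_
  simp [hpf, hqg]

theorem rePred_of_primrecPred {p : α → Prop} (hp : PrimrecPred p) : REPred p :=
  hp.computablePred.to_re

end RE

/-! ### Strings and cylinders -/

/-- The number with binary expansion `x`. -/
def strVal (x : Str) : ℕ := x.foldl (fun v b => 2 * v + b.toNat) 0

/-- The list of all strings of length `n`. -/
def strings : ℕ → List Str
  | 0 => [[]]
  | n + 1 => (strings n).flatMap fun x => [x ++ [false], x ++ [true]]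

theorem primrec_strVal : Primrec strVal := by
  have hb : Primrec Bool.toNat := Primrec.dom_finite _
  have h : Primrec₂ fun (_ : Str) (z : ℕ × Bool) => 2 * z.1 + z.2.toNat :=
    Primrec.nat_add.comp (Primrec.nat_mul.comp (Primrec.const 2)
      (Primrec.fst.comp Primrec.snd)) (hb.comp (Primrec.snd.comp Primrec.snd))
  exact Primrec.list_foldl Primrec.id (Primrec.const 0) h

theorem primrec_strings : Primrec strings := by
  have h : Primrec fun n : ℕ => Nat.rec (motive := fun _ => List Str) [[]]
      (fun _ l => l.flatMap fun x => [x ++ [false], x ++ [true]]) n := by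
    have hc (b : Bool) : Primrec fun z : (ℕ × List Str) × Str => z.2 ++ [b] :=
      Primrec.list_concat.comp Primrec.snd (Primrec.const b)
    have hg : Primrec₂ fun (_ : ℕ × List Str) (x : Str) => [x ++ [false], x ++ [true]] :=
      Primrec.list_cons.comp (hc false) (Primrec.list_cons.comp (hc true) (Primrec.const []))
    exact Primrec.nat_rec₁ _ (Primrec.list_flatMap Primrec.snd hg)
  refine h.of_eq fun n => ?_
  induction n with
  | zero => rfl
  | succ n ih => simp only [strings]; rw [← ih]

@[simp] theorem strVal_concat (x : Str) (b : Bool) :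
    strVal (x ++ [b]) = 2 * strVal x + b.toNat := by
  simp [strVal]

theorem mem_strings {x : Str} {n : ℕ} : x ∈ strings n ↔ x.length = n := by
  induction n generalizing x with
  | zero => simp [strings]
  | succ n ih =>
    simp only [strings, List.mem_flatMap, List.mem_cons, List.not_mem_nil, or_false, ih]
    constructor
    · rintro ⟨y, hy, rfl | rfl⟩ <;> simp [hy]
    · intro hx
      rcases List.eq_nil_or_concat x with rfl | ⟨y, b, rfl⟩
      · simp at hx
      · refine ⟨y, by simpa using hx, ?_⟩
        cases b <;> simp

theorem nodup_strings (n : ℕ) : (strings n).Nodup := by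
  induction n with
  | zero => simp [strings]
  | succ n ih =>
    rw [strings, List.nodup_flatMap]
    refine ⟨fun x _ => by simp, ih.imp fun {a b} hab => ?_⟩
    simp [Function.onFun, hab.symm]

@[simp] theorem length_initSeg (ω : Seq) (n : ℕ) : (initSeg ω n).length = n := by
  simp [initSeg]

theorem initSeg_succ (ω : Seq) (n : ℕ) : initSeg ω (n + 1) = initSeg ω n ++ [ω n] := by
  simp [initSeg, List.range_succ]

theorem take_initSeg (ω : Seq) {m n : ℕ} (h : m ≤ n) : (initSeg ω n).take m = initSeg ω m := by
  simp [initSeg, ← List.map_take, List.take_range, h]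

theorem mem_cyl_iff {x : Str} {ω : Seq} : ω ∈ cyl x ↔ initSeg ω x.length = x := by
  constructor
  · intro h
    refine List.ext_getElem (by simp) fun i hi hi' => ?_
    simp [initSeg, h i hi']
  · intro h i hi
    have : (initSeg ω x.length)[i]'(by simpa using hi) = x[i] := by simp only [h]
    simpa [initSeg] using this

theorem mem_cyl_initSeg_iff {ω ω' : Seq} {n : ℕ} :
    ω ∈ cyl (initSeg ω' n) ↔ initSeg ω n = initSeg ω' n := by
  simp [mem_cyl_iff]

theorem mem_cyl_initSeg (ω : Seq) (n : ℕ) : ω ∈ cyl (initSeg ω n) :=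
  mem_cyl_initSeg_iff.2 rfl

theorem initSeg_eq_of_le {ω ω' : Seq} {m n : ℕ} (hmn : m ≤ n) (h : initSeg ω n = initSeg ω' n) :
    initSeg ω m = initSeg ω' m := by
  rw [← take_initSeg ω hmn, h, take_initSeg ω' hmn]

theorem eq_of_initSeg_eq {ω ω' : Seq} (h : ∀ n, initSeg ω n = initSeg ω' n) : ω = ω' := by
  funext n
  have := h (n + 1)
  rw [initSeg_succ, initSeg_succ, h n] at this
  simpa using this

theorem exists_initSeg_eq (x : Str) : ∃ ω, initSeg ω x.length = x :=
  ⟨fun i => x.getD i false, by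
    refine List.ext_getElem (by simp) fun i hi hi' => ?_
    simp [initSeg, hi']⟩

theorem continuous_initSeg (n : ℕ) : Continuous[_, ⊥] fun ω : Seq => initSeg ω n := by
  let _ : TopologicalSpace Str := ⊥
  have : DiscreteTopology Str := ⟨rfl⟩
  induction n with
  | zero => simpa [initSeg] using continuous_const
  | succ n ih =>
    have h : (fun ω : Seq => initSeg ω (n + 1)) =
        (fun p : Str × Bool => p.1 ++ [p.2]) ∘ fun ω : Seq => (initSeg ω n, ω n) := by
      funext ω; simp [initSeg_succ]
    rw [h]
    exact continuous_of_discreteTopology.comp (ih.prodMk (continuous_apply n))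

/-- Closedness feeds the compactness arguments, openness gives measurability. -/
theorem isClopen_initSeg (n : ℕ) (p : Str → Prop) : IsClopen {ω : Seq | p (initSeg ω n)} := by
  let _ : TopologicalSpace Str := ⊥
  have : DiscreteTopology Str := ⟨rfl⟩
  exact (isClopen_discrete {x | p x}).preimage (continuous_initSeg n)

theorem measurableSet_initSeg (n : ℕ) (p : Str → Prop) :
    MeasurableSet {ω : Seq | p (initSeg ω n)} :=
  (isClopen_initSeg n p).isOpen.measurableSet

theorem cyl_eq (x : Str) : cyl x = {ω | initSeg ω x.length = x} :=
  Set.ext fun _ => mem_cyl_iff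

theorem measurableSet_cyl (x : Str) : MeasurableSet (cyl x) := by
  rw [cyl_eq]; exact measurableSet_initSeg _ (· = x)

theorem measurableSet_level {ι T : Type} [Countable ι] [MeasurableSpace T] {Δ : ι → Set T}
    (hΔ : ∀ i, MeasurableSet (Δ i)) (U : Set (ι × ℕ)) (n : ℕ) : MeasurableSet (level Δ U n) := by
  have : level Δ U n = ⋃ (i : ι) (_ : (i, n) ∈ U), Δ i := by ext; simp [level]
  rw [this]
  exact .iUnion fun i => .iUnion fun _ => hΔ i

/-! ### The numerical value of initial segments -/

theorem strVal_initSeg_succ (ω : Seq) (n : ℕ) :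
    strVal (initSeg ω (n + 1)) = 2 * strVal (initSeg ω n) + (ω n).toNat := by
  rw [initSeg_succ, strVal_concat]

/-- Extending a string by `s` bits stays in its dyadic interval; this is how strings of different
lengths are compared. -/
theorem strVal_initSeg_add (ω : Seq) (n s : ℕ) :
    strVal (initSeg ω n) * 2 ^ s ≤ strVal (initSeg ω (n + s)) ∧
      strVal (initSeg ω (n + s)) < (strVal (initSeg ω n) + 1) * 2 ^ s := by
  induction s with
  | zero => simp
  | succ s ih =>
    rw [← add_assoc, strVal_initSeg_succ, pow_succ]
    have := Bool.toNat_le (ω (n + s))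
    constructor <;> nlinarith [ih.1, ih.2]

theorem strVal_lt (x : Str) : strVal x < 2 ^ x.length := by
  induction x using List.reverseRecOn with
  | nil => simp [strVal]
  | append_singleton x b ih =>
    rw [strVal_concat, List.length_append, List.length_singleton, pow_succ]
    have := Bool.toNat_le b
    omega

theorem strVal_inj {x y : Str} (hl : x.length = y.length) (h : strVal x = strVal y) : x = y := by
  induction x using List.reverseRecOn generalizing y with
  | nil => simpa [eq_comm] using hl
  | append_singleton x b ih =>
    rcases List.eq_nil_or_concat y with rfl | ⟨y, c, rfl⟩
    · simp at hl
    · rw [List.concat_eq_append] at hl h ⊢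
      rw [strVal_concat, strVal_concat] at h
      have hb := Bool.toNat_le b
      have hc := Bool.toNat_le c
      have hbc : b.toNat = c.toNat := by omega
      rw [ih (by simpa using hl) (by omega), show b = c by cases b <;> cases c <;> simp_all]

theorem strVal_le_of_le {ω ω' : Seq} {m n : ℕ} (hmn : m ≤ n)
    (h : strVal (initSeg ω n) ≤ strVal (initSeg ω' n)) :
    strVal (initSeg ω m) ≤ strVal (initSeg ω' m) := by
  obtain ⟨s, rfl⟩ := Nat.exists_eq_add_of_le hmn
  have h1 := (strVal_initSeg_add ω m s).1
  have h2 := (strVal_initSeg_add ω' m s).2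
  have h3 := lt_of_mul_lt_mul_right (h1.trans_lt (h.trans_lt h2)) (Nat.zero_le _)
  omega

theorem initSeg_eq_of_strVal_eq {ω ω' : Seq} {n : ℕ}
    (h : strVal (initSeg ω n) = strVal (initSeg ω' n)) : initSeg ω n = initSeg ω' n :=
  strVal_inj (by simp) h

/-! ### The uniform measure -/

/-- The uniform measure on `Ω`. -/
noncomputable def coin : Measure Seq :=
  Measure.infinitePi fun _ => (PMF.uniformOfFintype Bool).toMeasure

instance : IsProbabilityMeasure coin := by unfold coin; infer_instance

theorem coin_cyl (x : Str) : coin (cyl x) = (2⁻¹ : ℝ≥0∞) ^ x.length := by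
  have h : cyl x = Set.pi (Finset.range x.length) fun i => {x.getD i false} := by
    ext ω
    simp only [cyl, Set.mem_ofPred_eq, Set.mem_pi, Finset.coe_range, Set.mem_Iio,
      Set.mem_singleton_iff]
    exact forall_congr' fun i => forall_congr' fun hi => by simp [hi]
  rw [h, coin, Measure.infinitePi_pi _ fun _ _ => measurableSet_singleton _]
  simp [PMF.uniformOfFintype_apply]

theorem coin_initSeg (n : ℕ) (p : Str → Prop) [DecidablePred p] :
    coin {ω | p (initSeg ω n)} =
      (((strings n).filter (p ·)).length : ℝ≥0∞) * (2⁻¹ : ℝ≥0∞) ^ n := by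
  classical
  set s : Finset Str := ((strings n).filter (p ·)).toFinset with hs
  have hcard : s.card = ((strings n).filter (p ·)).length :=
    List.toFinset_card_of_nodup ((nodup_strings n).filter _)
  have hmem : ∀ x, x ∈ s ↔ x.length = n ∧ p x := by simp [hs, mem_strings]
  have hU : {ω : Seq | p (initSeg ω n)} = ⋃ x ∈ s, cyl x := by
    ext ω
    simp only [Set.mem_ofPred_eq, Set.mem_iUnion, exists_prop, hmem, mem_cyl_iff]
    constructor
    · exact fun h => ⟨initSeg ω n, ⟨by simp, h⟩, by simp⟩
    · rintro ⟨x, ⟨hx, hp⟩, h⟩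
      rw [hx] at h
      rwa [h]
  rw [hU, measure_biUnion_finset]
  · rw [Finset.sum_congr rfl fun x hx => by rw [coin_cyl, ((hmem x).1 hx).1]]
    simp [hcard]
  · intro x hx y hy hxy
    refine Set.disjoint_left.2 fun ω h1 h2 => hxy ?_
    rw [mem_cyl_iff, ((hmem _).1 hx).1] at h1
    rw [mem_cyl_iff, ((hmem _).1 hy).1] at h2
    exact h1.symm.trans h2
  · exact fun x _ => measurableSet_cyl x

/-! ### A left-computably-enumerable random sequence -/

/-! ### An enumerable open set of measure at most one half containing all nonrandom sequences -/

section Universal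

open Encodable Denumerable Nat.Partrec

/-- Within `t` steps, the `e`-th program puts an initial segment of `z` into level `e + 2`. -/
def Hit (e t : ℕ) (z : Str) : Prop :=
  ∃ i < t + 1, (Code.evaln t (ofNat Code e) (encode (z.take i, e + 2))).isSome

open Classical in
/-- The strings of length `t` hit by the `e`-th program cover measure at most `2⁻⁽ᵉ⁺²⁾`. -/
def Small (e t : ℕ) : Prop :=
  ((strings t).filter (Hit e t ·)).length * 2 ^ (e + 2) ≤ 2 ^ t

/-- `z` is hit before stage `s` by a test that looks correct at that time. -/
def Bad (s : ℕ) (z : Str) : Prop :=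
  ∃ e < s + 1, ∃ t < s + 1, Small e t ∧ Hit e t (z.take t)

theorem primrec_two_pow {α : Type} [Primcodable α] {f : α → ℕ} (hf : Primrec f) :
    Primrec fun a => 2 ^ f a :=
  (Primrec₂.unpaired'.1 Nat.Primrec.pow).comp (Primrec.const 2) hf

theorem primrecPred_hit : PrimrecPred fun y : (ℕ × ℕ) × Str => Hit y.1.1 y.1.2 y.2 := by
  have he : Primrec fun y : ℕ × (ℕ × ℕ) × Str => y.2.1.1 :=
    Primrec.fst.comp (Primrec.fst.comp Primrec.snd)
  have ht : Primrec fun y : ℕ × (ℕ × ℕ) × Str => y.2.1.2 :=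
    Primrec.snd.comp (Primrec.fst.comp Primrec.snd)
  have hz : Primrec fun y : ℕ × (ℕ × ℕ) × Str => y.2.2 := Primrec.snd.comp Primrec.snd
  have h1 : Primrec fun y : ℕ × (ℕ × ℕ) × Str =>
      (Code.evaln y.2.1.2 (ofNat Code y.2.1.1) (encode (y.2.2.take y.1, y.2.1.1 + 2))).isSome :=
    Primrec.option_isSome.comp (Code.primrec_evaln.comp
      ((ht.pair ((Primrec.ofNat Code).comp he)).pair (Primrec.encode.comp
        ((Primrec.list_take.comp Primrec.fst hz).pair
          (Primrec.nat_add.comp he (Primrec.const 2))))))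
  have h2 : PrimrecRel fun (i : ℕ) (y : (ℕ × ℕ) × Str) =>
      (Code.evaln y.1.2 (ofNat Code y.1.1) (encode (y.2.take i, y.1.1 + 2))).isSome = true :=
    Primrec.eq.comp h1 (Primrec.const true)
  exact (h2.exists_mem_list.comp (Primrec.list_range.comp
    (Primrec.succ.comp (Primrec.snd.comp Primrec.fst))) Primrec.id).of_eq fun y => by
      simp [Hit]

theorem primrecRel_small : PrimrecRel Small := by
  classical
  have h1 : PrimrecRel fun (z : Str) (y : ℕ × ℕ) => Hit y.1 y.2 z :=
    primrecPred_hit.comp (Primrec.snd.pair Primrec.fst)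
  have h2 : Primrec fun y : ℕ × ℕ => (strings y.2).filter (Hit y.1 y.2 ·) :=
    h1.listFilter.comp (primrec_strings.comp Primrec.snd) Primrec.id
  exact Primrec.nat_le.comp (Primrec.nat_mul.comp (Primrec.list_length.comp h2)
    (primrec_two_pow (Primrec.nat_add.comp Primrec.fst (Primrec.const 2))))
    (primrec_two_pow Primrec.snd)

theorem primrecRel_bad : PrimrecRel Bad := by
  have he : Primrec fun y : ℕ × (ℕ × ℕ × Str) => y.2.1 := Primrec.fst.comp Primrec.snd
  have hz : Primrec fun y : ℕ × (ℕ × ℕ × Str) => y.2.2.2 :=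
    Primrec.snd.comp (Primrec.snd.comp Primrec.snd)
  have h1 : PrimrecRel fun (t : ℕ) (y : ℕ × ℕ × Str) =>
      Small y.1 t ∧ Hit y.1 t (y.2.2.take t) :=
    (primrecRel_small.comp he Primrec.fst).and
      (primrecPred_hit.comp ((he.pair Primrec.fst).pair (Primrec.list_take.comp Primrec.fst hz)))
  have h2 : PrimrecRel fun (e : ℕ) (y : ℕ × Str) =>
      ∃ t ∈ List.range (y.1 + 1), Small e t ∧ Hit e t (y.2.take t) :=
    h1.exists_mem_list.comp (Primrec.list_range.comp
      (Primrec.succ.comp (Primrec.fst.comp Primrec.snd))) Primrec.id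
  exact (h2.exists_mem_list.comp (Primrec.list_range.comp
    (Primrec.succ.comp Primrec.fst)) Primrec.id).of_eq fun y => by simp [Bad]

theorem Hit.mono {e t t' : ℕ} (htt : t ≤ t') {ω : Seq} (h : Hit e t (initSeg ω t)) :
    Hit e t' (initSeg ω t') := by
  obtain ⟨i, hi, h⟩ := h
  refine ⟨i, by omega, ?_⟩
  rw [take_initSeg _ (by omega)] at h ⊢
  rw [Option.isSome_iff_exists] at h ⊢
  exact h.imp fun a ha => Code.evaln_mono htt ha

theorem bad_initSeg_iff {s : ℕ} {ω : Seq} :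
    Bad s (initSeg ω s) ↔ ∃ e ≤ s, ∃ t ≤ s, Small e t ∧ Hit e t (initSeg ω t) := by
  simp only [Bad, Nat.lt_succ_iff]
  refine exists_congr fun e => and_congr_right fun _ => exists_congr fun t =>
    and_congr_right fun ht => ?_
  rw [take_initSeg _ ht]

theorem bad_mono {s s' : ℕ} (hs : s ≤ s') {ω : Seq} (h : Bad s (initSeg ω s)) :
    Bad s' (initSeg ω s') := by
  rw [bad_initSeg_iff] at h ⊢
  obtain ⟨e, he, t, ht, h⟩ := h
  exact ⟨e, he.trans hs, t, ht.trans hs, h⟩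

theorem natCast_mul_inv_two_pow_le_iff {c m t : ℕ} :
    (c : ℝ≥0∞) * (2⁻¹ : ℝ≥0∞) ^ t ≤ (2⁻¹ : ℝ≥0∞) ^ m ↔ c * 2 ^ m ≤ 2 ^ t := by
  rw [← ENNReal.inv_pow, ← ENNReal.inv_pow, ← div_eq_mul_inv, ENNReal.div_le_iff (by simp)
    (by simp), mul_comm, ← div_eq_mul_inv, ENNReal.le_div_iff_mul_le (by simp) (by simp)]
  exact_mod_cast Iff.rfl

theorem coin_hit_le_iff {e t : ℕ} :
    coin {ω | Hit e t (initSeg ω t)} ≤ (2⁻¹ : ℝ≥0∞) ^ (e + 2) ↔ Small e t := by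
  classical
  rw [coin_initSeg, natCast_mul_inv_two_pow_le_iff, Small]

/-- Every sequence that is not random is covered by the bad strings. -/
theorem exists_bad_of_notMem_mlRandom {ω : Seq} (hω : ω ∉ mlRandom cyl coin) :
    ∃ s, Bad s (initSeg ω s) := by
  simp only [mlRandom, Set.mem_compl_iff, not_not, Set.mem_iUnion, Set.mem_iInter,
    exists_prop] at hω
  obtain ⟨U, ⟨hU, hlev⟩, hω⟩ := hω
  obtain ⟨c, hc⟩ := exists_code_of_rePred hU
  -- Everything the program hits lies in a level of a genuine test, so its size check succeeds at
  -- every time.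
  have hsub (t : ℕ) : {ω | Hit (encode c) t (initSeg ω t)} ⊆ level cyl U (encode c + 2) := by
    rintro ω' ⟨i, hi, h⟩
    rw [take_initSeg _ (by omega), ofNat_encode] at h
    exact ⟨_, (hc _).2 ⟨t, h⟩, mem_cyl_initSeg _ _⟩
  obtain ⟨x, hx, hωx⟩ := hω (encode c + 2)
  obtain ⟨k, hk⟩ := (hc _).1 hx
  have hsmall (t : ℕ) : Small (encode c) t :=
    coin_hit_le_iff.1 ((measure_mono (hsub t)).trans (hlev _).2.le)
  set t := max k x.length
  refine ⟨max (encode c) t, bad_initSeg_iff.2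
    ⟨encode c, le_max_left _ _, t, le_max_right _ _, hsmall t, x.length, ?_, ?_⟩⟩
  · exact Nat.lt_succ_of_le (le_max_right _ _)
  · rw [take_initSeg _ (le_max_right _ _), ofNat_encode, mem_cyl_iff.1 hωx]
    rw [Option.isSome_iff_exists] at hk ⊢
    exact hk.imp fun a ha => Code.evaln_mono (le_max_left _ _) ha

/-- For fixed `e` the hit sets increase with `t`, so those passing the size check have a union no
larger than their common bound `2⁻⁽ᵉ⁺²⁾`, even if later stages fail the check. These bounds sum to
one half. -/
theorem coin_bad_le : coin {ω | ∃ s, Bad s (initSeg ω s)} ≤ 2⁻¹ := by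
  have hsub : {ω | ∃ s, Bad s (initSeg ω s)} ⊆
      ⋃ e, ⋃ t : {t // Small e t}, {ω | Hit e t (initSeg ω t)} := by
    rintro ω ⟨s, hs⟩
    obtain ⟨e, _, t, _, h1, h2⟩ := bad_initSeg_iff.1 hs
    exact Set.mem_iUnion.2 ⟨e, Set.mem_iUnion.2 ⟨⟨t, h1⟩, h2⟩⟩
  have he (e : ℕ) : coin (⋃ t : {t // Small e t}, {ω | Hit e t (initSeg ω t)}) ≤
      (2⁻¹ : ℝ≥0∞) ^ (e + 2) := by
    have hmono : Monotone fun t : {t // Small e t} => {ω : Seq | Hit e t (initSeg ω t)} :=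
      fun t t' htt ω h => Hit.mono htt h
    rw [hmono.directed_le.measure_iUnion]
    exact iSup_le fun t => coin_hit_le_iff.2 t.2
  calc coin {ω | ∃ s, Bad s (initSeg ω s)}
      ≤ ∑' e, (2⁻¹ : ℝ≥0∞) ^ (e + 2) :=
        (measure_mono hsub).trans ((measure_iUnion_le _).trans (ENNReal.tsum_le_tsum he))
    _ = 2⁻¹ := by
        have h2 (e : ℕ) : (2⁻¹ : ℝ≥0∞) ^ (e + 2) = (2⁻¹ : ℝ≥0∞) ^ (e + 1) * 2⁻¹ := by
          rw [← pow_succ]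
        simp_rw [h2]
        rw [ENNReal.tsum_mul_right, ENNReal.tsum_geometric_add_one]
        rw [ENNReal.one_sub_inv_two, inv_inv, ENNReal.inv_mul_cancel (by simp) (by simp), one_mul]

end Universal

/-! ### The leftmost sequence that is never bad -/

theorem foldr_min_le {l : List ℕ} {a d : ℕ} (ha : a ∈ l) : l.foldr min d ≤ a := by
  induction l with
  | nil => simp at ha
  | cons b l ih =>
    rcases List.mem_cons.1 ha with rfl | h
    · simp
    · exact (min_le_right _ _).trans (ih h)

theorem foldr_min_mem {l : List ℕ} {d : ℕ} : l.foldr min d ∈ l ∨ l.foldr min d = d := by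
  induction l with
  | nil => simp
  | cons b l ih =>
    rw [List.foldr_cons]
    rcases min_choice b (l.foldr min d) with h | h <;> rw [h]
    · simp
    · exact ih.imp_left (List.mem_cons_of_mem _)

theorem exists_primrec_isLeast {R : ℕ → Str → Prop} (hR : PrimrecRel R)
    (hex : ∀ s, ∃ ω : Seq, R s (initSeg ω s)) :
    ∃ h : ℕ → ℕ, Primrec h ∧
      ∀ s, IsLeast {v | ∃ ω : Seq, R s (initSeg ω s) ∧ strVal (initSeg ω s) = v} (h s) := by
  classical
  have h1 : PrimrecRel fun (z : Str) (s : ℕ) => R s z := hR.comp Primrec.snd Primrec.fst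
  have h2 : Primrec fun s : ℕ => (strings s).filter (R s ·) :=
    h1.listFilter.comp primrec_strings Primrec.id
  have h3 : Primrec fun s : ℕ => (((strings s).filter (R s ·)).map strVal) :=
    Primrec.list_map h2 (primrec_strVal.comp Primrec.snd)
  have hmin : Primrec₂ fun (_ : ℕ) (z : ℕ × ℕ) => min z.1 z.2 :=
    Primrec.nat_min.comp (Primrec.fst.comp Primrec.snd) (Primrec.snd.comp Primrec.snd)
  have hmem (s : ℕ) (ω : Seq) (h : R s (initSeg ω s)) :
      strVal (initSeg ω s) ∈ ((strings s).filter (R s ·)).map strVal :=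
    List.mem_map_of_mem (List.mem_filter.2 ⟨mem_strings.2 (by simp), by simpa using h⟩)
  -- The default `2 ^ s` exceeds the value of every string of length `s`, so it is never the
  -- minimum.
  refine ⟨_, Primrec.list_foldr h3 (primrec_two_pow Primrec.id) hmin, fun s => ⟨?_, ?_⟩⟩
  · rcases foldr_min_mem (l := ((strings s).filter (R s ·)).map strVal) (d := 2 ^ s) with h | h
    · obtain ⟨z, hz, hv⟩ := List.mem_map.1 h
      obtain ⟨hz1, hz2⟩ := List.mem_filter.1 hz
      rw [mem_strings] at hz1
      obtain ⟨ω, hω⟩ := exists_initSeg_eq z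
      rw [hz1] at hω
      exact ⟨ω, by simpa [hω] using hz2, by rw [hω]; exact hv⟩
    · obtain ⟨ω, hω⟩ := hex s
      have h3 := foldr_min_le (d := 2 ^ s) (hmem s ω hω)
      have h4 := strVal_lt (initSeg ω s)
      rw [length_initSeg] at h4
      exact absurd (h3.trans_lt h4) (by rw [h]; simp)
  · rintro v ⟨ω, hω, rfl⟩
    exact foldr_min_le (hmem s ω hω)

/-- A nonempty closed set of sequences has a least element for the lexicographic order. -/
theorem exists_least_of_isClosed {K : Set Seq} (hK : IsClosed K) (hne : K.Nonempty) :
    ∃ ξ ∈ K, ∀ ω ∈ K, ∀ n, strVal (initSeg ξ n) ≤ strVal (initSeg ω n) := by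
  set w : ℕ → ℕ := fun n => sInf ((fun ω => strVal (initSeg ω n)) '' K) with hw
  have hle (n : ℕ) {ω : Seq} (hω : ω ∈ K) : w n ≤ strVal (initSeg ω n) :=
    Nat.sInf_le ⟨ω, hω, rfl⟩
  have hmem (n : ℕ) : ∃ ω ∈ K, strVal (initSeg ω n) = w n :=
    Nat.sInf_mem (hne.image fun ω => strVal (initSeg ω n))
  have hcl (n : ℕ) : IsClosed (K ∩ {ω | strVal (initSeg ω n) = w n}) :=
    hK.inter (isClopen_initSeg n fun x => strVal x = w n).isClosed
  -- Minimality at length `n + 1` forces minimality at length `n`, so the sets of minimizers are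
  -- nested.
  obtain ⟨ξ, hξ⟩ := IsCompact.nonempty_iInter_of_sequence_nonempty_isCompact_isClosed
    (fun n => K ∩ {ω | strVal (initSeg ω n) = w n}) (fun n ω => by
      rintro ⟨hω, h⟩
      refine ⟨hω, ?_⟩
      obtain ⟨ω', hω', h'⟩ := hmem n
      have h1 := hle (n + 1) hω'
      have h2 := hle n hω
      have h3 : strVal (initSeg ω (n + 1)) = w (n + 1) := h
      rw [strVal_initSeg_succ] at h1 h3
      have := Bool.toNat_le (ω' n)
      change strVal (initSeg ω n) = w n
      omega) (fun n => (hmem n).imp fun ω h => ⟨h.1, h.2⟩) (hcl 0).isCompact hcl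
  rw [Set.mem_iInter] at hξ
  exact ⟨ξ, (hξ 0).1, fun ω hω n => (hξ n).2.trans_le (hle n hω)⟩

/-- There is a random sequence `ξ` that is the limit of a computable sequence of strings which
increases in the lexicographic order; `h n` is the numerical value of the `n`-th string. -/
theorem exists_leftCE_random : ∃ (h : ℕ → ℕ) (ξ : Seq), Primrec h ∧ (∀ s, 2 * h s ≤ h (s + 1)) ∧
    (∀ n, h n ≤ strVal (initSeg ξ n)) ∧ (∀ n, ∃ s, strVal (initSeg ξ n) * 2 ^ s ≤ h (n + s)) ∧
    ξ ∈ mlRandom cyl coin := by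
  set K : Set Seq := {ω | ∀ s, ¬ Bad s (initSeg ω s)} with hKdef
  have hKc : IsClosed K := by
    have : K = ⋂ s, {ω | ¬ Bad s (initSeg ω s)} := by ext; simp [hKdef]
    rw [this]
    exact isClosed_iInter fun s => (isClopen_initSeg s fun x => ¬ Bad s x).isClosed
  have hKne : K.Nonempty := by
    by_contra hne
    have huniv : {ω | ∃ s, Bad s (initSeg ω s)} = Set.univ := by
      refine Set.eq_univ_of_forall fun ω => ?_
      by_contra hω
      exact hne ⟨ω, fun s hs => hω ⟨s, hs⟩⟩
    have h := coin_bad_le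
    rw [huniv, measure_univ] at h
    exact absurd h (by simp)
  obtain ⟨ω₀, hω₀⟩ := hKne
  obtain ⟨ξ, hξK, hξ⟩ := exists_least_of_isClosed hKc ⟨ω₀, hω₀⟩
  obtain ⟨h, hh, hleast⟩ := exists_primrec_isLeast primrecRel_bad.not fun s => ⟨ω₀, hω₀ s⟩
  refine ⟨h, ξ, hh, fun s => ?_, fun n => (hleast n).2 ⟨ξ, hξK n, rfl⟩, fun n => ?_, ?_⟩
  · obtain ⟨ω, hω, hv⟩ := (hleast (s + 1)).1
    -- Badness persists, so the minimizer at stage `s + 1` was already a competitor at stage `s`.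
    have h1 := (hleast s).2 ⟨ω, fun hb => hω (bad_mono s.le_succ hb), rfl⟩
    rw [strVal_initSeg_succ] at hv
    omega
  -- Otherwise every stage leaves a sequence that is not yet bad and lies strictly below `ξ` at
  -- length `n`; compactness yields one in `K`, against the minimality of `ξ`.
  · by_contra hcon
    push Not at hcon
    have hne (s : ℕ) : ∃ ω : Seq, ¬ Bad (n + s) (initSeg ω (n + s)) ∧
        strVal (initSeg ω n) < strVal (initSeg ξ n) := by
      obtain ⟨ω, hω, hv⟩ := (hleast (n + s)).1
      refine ⟨ω, hω, ?_⟩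
      have h1 := (strVal_initSeg_add ω n s).1
      rw [hv] at h1
      exact lt_of_mul_lt_mul_right (h1.trans_lt (hcon s)) (Nat.zero_le _)
    have hcl (s : ℕ) : IsClosed ({ω : Seq | ¬ Bad (n + s) (initSeg ω (n + s))} ∩
        {ω | strVal (initSeg ω n) < strVal (initSeg ξ n)}) :=
      (isClopen_initSeg (n + s) fun x => ¬ Bad (n + s) x).isClosed.inter
        (isClopen_initSeg n fun x => strVal x < strVal (initSeg ξ n)).isClosed
    obtain ⟨ω, hω⟩ := IsCompact.nonempty_iInter_of_sequence_nonempty_isCompact_isClosed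
      (fun s => {ω : Seq | ¬ Bad (n + s) (initSeg ω (n + s))} ∩
        {ω | strVal (initSeg ω n) < strVal (initSeg ξ n)})
      (fun s ω hω => ⟨fun hb => hω.1 (bad_mono (by omega) hb), hω.2⟩)
      (fun s => (hne s).imp fun ω h => ⟨h.1, h.2⟩) (hcl 0).isCompact hcl
    rw [Set.mem_iInter] at hω
    have hωK : ω ∈ K := fun s hb => (hω s).1 (bad_mono (by omega) hb)
    exact absurd (hω 0).2 (not_lt.2 (hξ ω hωK n))
  · by_contra hr
    obtain ⟨s, hs⟩ := exists_bad_of_notMem_mlRandom hr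
    exact hξK s hs

/-! ### Tests and conditional probabilities -/

section Tests

variable {ι T : Type} [Primcodable ι] [MeasurableSpace T] {Δ : ι → Set T}

theorem notMem_mlRandom_iff {μ : Measure T} {t : T} :
    t ∉ mlRandom Δ μ ↔ ∃ U, IsTest Δ μ U ∧ ∀ n, t ∈ level Δ U n := by
  simp [mlRandom]

/-- Every level containing an atom has at least its mass, so the levels cannot shrink to measure
zero. -/
theorem mem_mlRandom_of_atom {μ : Measure T} {t : T} (ht : μ {t} ≠ 0) : t ∈ mlRandom Δ μ := by
  by_contra h
  obtain ⟨U, ⟨_, hU⟩, htU⟩ := notMem_mlRandom_iff.1 h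
  obtain ⟨n, hn⟩ := ENNReal.exists_inv_two_pow_lt ht
  exact absurd (hn.trans_le (measure_mono (Set.singleton_subset_iff.2 (htU n)))) (hU n).2.not_gt

theorem notMem_mlRandom_of_null {μ : Measure T} {i : ι} {t : T} (hi : μ (Δ i) = 0)
    (ht : t ∈ Δ i) : t ∉ mlRandom Δ μ := by
  have hlev (n : ℕ) : level Δ {p : ι × ℕ | p.1 = i} n = Δ i := by ext; simp [level]
  refine notMem_mlRandom_iff.2 ⟨{p | p.1 = i}, ⟨?_, fun n => ?_⟩, fun n => ?_⟩
  · exact rePred_of_primrecPred (Primrec.eq.comp Primrec.fst (Primrec.const i))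
  · rw [hlev, hlev, hi]
    exact ⟨subset_rfl, ENNReal.pow_pos (by simp) n⟩
  · rwa [hlev]

/-- Dropping the first `k` levels of a test absorbs the factor `c⁻¹` introduced by conditioning. -/
theorem two_pow_mul_lt {a c : ℝ≥0∞} {n k : ℕ} (hc : (2⁻¹ : ℝ≥0∞) ^ k < c)
    (ha : a < (2⁻¹ : ℝ≥0∞) ^ (n + k)) : c⁻¹ * a < (2⁻¹ : ℝ≥0∞) ^ n := by
  have h2 : (2⁻¹ : ℝ≥0∞) ^ k ≠ 0 := (ENNReal.pow_pos (by simp) k).ne'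
  have h3 : (2⁻¹ : ℝ≥0∞) ^ k ≠ ⊤ := ENNReal.pow_ne_top (by simp)
  calc c⁻¹ * a ≤ ((2⁻¹ : ℝ≥0∞) ^ k)⁻¹ * a := by gcongr
    _ < ((2⁻¹ : ℝ≥0∞) ^ k)⁻¹ * (2⁻¹ : ℝ≥0∞) ^ (n + k) :=
        ENNReal.mul_lt_mul_right (by simp) (by simp) ha
    _ = (2⁻¹ : ℝ≥0∞) ^ n := by
        rw [pow_add, mul_comm, mul_assoc, ENNReal.mul_inv_cancel h2 h3, mul_one]

/-- If `ν` is dominated by a multiple of `μ` then every `ν`-random point is `μ`-random. -/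
theorem mlRandom_subset_of_le {μ ν : Measure T} {c : ℝ≥0∞} (hc : c ≠ 0)
    (hle : ∀ U : Set (ι × ℕ), ∀ n, ν (level Δ U n) ≤ c⁻¹ * μ (level Δ U n)) :
    mlRandom Δ ν ⊆ mlRandom Δ μ := by
  intro t ht
  contrapose ht
  obtain ⟨U, ⟨hre, hU⟩, htU⟩ := notMem_mlRandom_iff.1 ht
  obtain ⟨k, hk⟩ := ENNReal.exists_inv_two_pow_lt hc
  have hlev (n : ℕ) : level Δ {p : ι × ℕ | (p.1, p.2 + k) ∈ U} n = level Δ U (n + k) := rfl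
  refine notMem_mlRandom_iff.2 ⟨{p | (p.1, p.2 + k) ∈ U}, ⟨?_, fun n => ?_⟩, fun n => ?_⟩
  · exact rePred_comp hre (f := fun p : ι × ℕ => (p.1, p.2 + k))
      (Primrec.fst.pair (Primrec.nat_add.comp Primrec.snd (Primrec.const k))).to_comp
  · rw [hlev, hlev]
    refine ⟨?_, (hle U _).trans_lt (two_pow_mul_lt hk (hU _).2)⟩
    rw [add_right_comm]
    exact (hU _).1
  · rw [hlev]; exact htU _

end Tests

/-! ### Cylinders determine a probability measure -/

theorem isPiSystem_cyl : IsPiSystem (Set.range cyl) := by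
  rintro _ ⟨x, rfl⟩ _ ⟨y, rfl⟩ ⟨ω, hx, hy⟩
  have key {x y : Str} {ω : Seq} (hx : ω ∈ cyl x) (hy : ω ∈ cyl y) (h : x.length ≤ y.length) :
      cyl y ⊆ cyl x := by
    intro ω' hω'
    rw [mem_cyl_iff] at *
    rw [← hx]
    simpa using initSeg_eq_of_le h (hω'.trans hy.symm)
  rcases le_total x.length y.length with h | h
  · exact ⟨y, (Set.inter_eq_right.2 (key hx hy h)).symm⟩
  · exact ⟨x, (Set.inter_eq_left.2 (key hy hx h)).symm⟩

theorem generateFrom_cyl :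
    (inferInstance : MeasurableSpace Seq) = MeasurableSpace.generateFrom (Set.range cyl) := by
  refine le_antisymm (iSup_le fun i => ?_) (MeasurableSpace.generateFrom_le ?_)
  · rw [← measurable_iff_comap_le]
    refine @measurable_to_bool _ (MeasurableSpace.generateFrom (Set.range cyl)) _ ?_
    have : (fun ω : Seq => ω i) ⁻¹' {true} =
        ⋃ (x : Str) (_ : x.length = i + 1 ∧ x[i]? = some true), cyl x := by
      ext ω
      simp only [Set.mem_preimage, Set.mem_singleton_iff, Set.mem_iUnion, exists_prop]
      constructor
      · intro h
        exact ⟨initSeg ω (i + 1), ⟨by simp, by simp [initSeg, h]⟩, mem_cyl_initSeg _ _⟩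
      · rintro ⟨x, ⟨hx, hxi⟩, hω⟩
        rw [List.getElem?_eq_some_iff] at hxi
        obtain ⟨hi, hxi⟩ := hxi
        rw [hω i hi, hxi]
    rw [this]
    exact MeasurableSet.iUnion fun x => MeasurableSet.iUnion fun _ =>
      MeasurableSpace.measurableSet_generateFrom ⟨x, rfl⟩
  · rintro _ ⟨x, rfl⟩
    exact measurableSet_cyl x

theorem ext_of_cyl {μ ν : Measure Seq} [IsProbabilityMeasure μ] [IsProbabilityMeasure ν]
    (h : ∀ x, μ (cyl x) = ν (cyl x)) : μ = ν :=
  ext_of_generate_finite _ generateFrom_cyl isPiSystem_cyl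
    (by rintro _ ⟨x, rfl⟩; exact h x) (by simp)

/-! ### Conditioning on an atom of the second marginal -/

section Cond

variable {P : Measure (Seq × Seq)}

theorem condStr_apply (y : Str) {A : Set Seq} (hA : MeasurableSet A) :
    condStr P y A =
      (P (Prod.snd ⁻¹' cyl y))⁻¹ * P (Prod.snd ⁻¹' cyl y ∩ Prod.fst ⁻¹' A) := by
  rw [condStr, Measure.fst_apply hA,
    ProbabilityTheory.cond_apply (measurable_snd (measurableSet_cyl y))]

/-- The conditional distribution of the first coordinate given that the second equals `η`. -/
noncomputable def condPoint (P : Measure (Seq × Seq)) (η : Seq) : Measure Seq :=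
  (ProbabilityTheory.cond P (Prod.snd ⁻¹' {η})).fst

theorem condPoint_apply (η : Seq) {A : Set Seq} (hA : MeasurableSet A) :
    condPoint P η A = (P.snd {η})⁻¹ * P (Prod.snd ⁻¹' {η} ∩ Prod.fst ⁻¹' A) := by
  rw [condPoint, Measure.fst_apply hA, ProbabilityTheory.cond_apply
    (measurable_snd (measurableSet_singleton η)), Measure.snd_apply (measurableSet_singleton η)]

theorem iInter_cyl_initSeg (η : Seq) : ⋂ n, cyl (initSeg η n) = {η} := by
  ext ω
  simp only [Set.mem_iInter, mem_cyl_initSeg_iff, Set.mem_singleton_iff]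
  exact ⟨eq_of_initSeg_eq, by rintro rfl _; rfl⟩

theorem antitone_cyl_initSeg (η : Seq) : Antitone fun n => cyl (initSeg η n) := by
  intro m n hmn ω hω
  rw [mem_cyl_initSeg_iff] at *
  exact initSeg_eq_of_le hmn hω

/-- The cylinders around `η` shrink to `{η}`, so numerator and denominator converge by continuity
from above, the latter to a nonzero limit. -/
theorem isCondAt_condPoint [IsProbabilityMeasure P] {η : Seq} (hη : P.snd {η} ≠ 0) :
    IsCondAt P η (condPoint P η) := by
  have hη' : P (Prod.snd ⁻¹' {η}) ≠ 0 := by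
    rwa [Measure.snd_apply (measurableSet_singleton η)] at hη
  have := ProbabilityTheory.cond_isProbabilityMeasure hη'
  refine ⟨by unfold condPoint; infer_instance, fun x => ?_⟩
  have hlim {A : Set (Seq × Seq)} (hA : MeasurableSet A) :
      Tendsto (fun n => P (Prod.snd ⁻¹' cyl (initSeg η n) ∩ A)) atTop
        (𝓝 (P (Prod.snd ⁻¹' {η} ∩ A))) := by
    rw [← iInter_cyl_initSeg, Set.preimage_iInter, Set.iInter_inter]
    refine tendsto_measure_iInter_atTop (fun n => ?_) (fun m n hmn => ?_) ⟨0, measure_ne_top _ _⟩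
    · exact ((measurable_snd (measurableSet_cyl _)).inter hA).nullMeasurableSet
    · exact Set.inter_subset_inter_left _ (Set.preimage_mono (antitone_cyl_initSeg η hmn))
  simp_rw [condStr_apply _ (measurableSet_cyl x), condPoint_apply _ (measurableSet_cyl x)]
  have h1 := hlim MeasurableSet.univ
  simp only [Set.inter_univ] at h1
  rw [Measure.snd_apply (measurableSet_singleton η)]
  exact ENNReal.Tendsto.mul (tendsto_inv_iff.2 h1) (Or.inr (measure_ne_top _ _))
    (hlim (measurable_fst (measurableSet_cyl x))) (Or.inr (ENNReal.inv_ne_top.2 hη'))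

theorem isCondAt_condAt {η : Seq} {ν : Measure Seq} (h : IsCondAt P η ν) :
    IsCondAt P η (condAt P η) := by
  have hex : ∃ ν, IsCondAt P η ν := ⟨ν, h⟩
  rw [condAt, dif_pos hex]
  exact hex.choose_spec

theorem condAt_eq {η : Seq} {ν : Measure Seq} (h : IsCondAt P η ν) : condAt P η = ν := by
  have h' := isCondAt_condAt h
  have := h.1
  have := h'.1
  exact ext_of_cyl fun x => tendsto_nhds_unique (h'.2 x) (h.2 x)

theorem condPoint_le (η : Seq) {A : Set Seq} (hA : MeasurableSet A) :
    condPoint P η A ≤ (P.snd {η})⁻¹ * P.fst A := by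
  rw [condPoint_apply η hA, Measure.fst_apply hA]
  gcongr
  exact Set.inter_subset_right

theorem mlRandom_condPoint_subset {η : Seq} (hη : P.snd {η} ≠ 0) :
    mlRandom cyl (condPoint P η) ⊆ mlRandom cyl P.fst :=
  mlRandom_subset_of_le hη fun U n => condPoint_le η (measurableSet_level measurableSet_cyl U n)

theorem measurableSet_cyl₂ (p : Str × Str) : MeasurableSet (cyl₂ p) :=
  (measurableSet_cyl p.1).prod (measurableSet_cyl p.2)

theorem primrec_replicate_true : Primrec fun n => List.replicate n true := by
  refine (Primrec.list_map Primrec.list_range (Primrec.const true).to₂).of_eq fun n => ?_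
  exact List.eq_replicate_iff.2 ⟨by simp, by simp⟩

theorem mem_cyl_replicate_true_ones (n : ℕ) : ones ∈ cyl (List.replicate n true) := by
  intro i hi
  simp [ones]

theorem eq_replicate_of_ones_mem_cyl {y : Str} (h : ones ∈ cyl y) :
    y = List.replicate y.length true := by
  rw [mem_cyl_iff] at h
  refine List.eq_replicate_iff.2 ⟨rfl, fun b hb => ?_⟩
  rw [← h] at hb
  simp [initSeg, ones] at hb
  exact hb.2

/-- At an atom, here `1^∞`, the randomness of a pair is weaker than the randomness of its first
component with respect to the conditional probability. -/
theorem mlRandom_condPoint_ones_subset (hP : P.snd {ones} ≠ 0) :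
    mlRandom cyl (condPoint P ones) ⊆ randomSection P ones := by
  intro ω hω
  contrapose hω
  obtain ⟨U, ⟨hre, hU⟩, htU⟩ := notMem_mlRandom_iff.1 hω
  obtain ⟨k, hk⟩ := ENNReal.exists_inv_two_pow_lt hP
  -- The strings beginning `1^∞` are exactly the runs of ones, so the section of a test at `1^∞` is
  -- still enumerable.
  set V : Set (Str × ℕ) := {p | ∃ m, ((p.1, List.replicate m true), p.2 + k) ∈ U} with hV
  have hlev (n : ℕ) : level cyl V n = {ω | (ω, ones) ∈ level cyl₂ U (n + k)} := by
    ext ω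
    constructor
    · rintro ⟨x, ⟨m, hm⟩, hx⟩
      exact ⟨_, hm, hx, mem_cyl_replicate_true_ones m⟩
    · rintro ⟨⟨x, y⟩, hm, hx, hy⟩
      exact ⟨x, ⟨y.length, by rwa [← eq_replicate_of_ones_mem_cyl hy]⟩, hx⟩
  refine notMem_mlRandom_iff.2 ⟨V, ⟨?_, fun n => ⟨?_, ?_⟩⟩, fun n => ?_⟩
  · refine rePred_exists (rePred_comp hre
      (f := fun q : (Str × ℕ) × ℕ => ((q.1.1, List.replicate q.2 true), q.1.2 + k)) ?_)
    exact (((Primrec.fst.comp Primrec.fst).pair (primrec_replicate_true.comp Primrec.snd)).pair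
      (Primrec.nat_add.comp (Primrec.snd.comp Primrec.fst) (Primrec.const k))).to_comp
  · rw [hlev, hlev, add_right_comm]
    exact fun ω h => (hU _).1 h
  · rw [condPoint_apply _ (measurableSet_level measurableSet_cyl V n)]
    refine two_pow_mul_lt hk (lt_of_le_of_lt (measure_mono ?_) (hU (n + k)).2)
    rintro ⟨ω, ω'⟩ ⟨rfl, h⟩
    rw [hlev] at h
    exact h
  · rw [hlev]; exact htU _

end Cond

/-! ### A sequence all of whose initial segments can be enumerated is not random -/

theorem two_inv_pow_succ_lt (n : ℕ) : (2⁻¹ : ℝ≥0∞) ^ (n + 1) < (2⁻¹ : ℝ≥0∞) ^ n := by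
  rw [pow_succ, ← div_eq_mul_inv]
  exact ENNReal.half_lt_self (ENNReal.pow_pos (by simp) n).ne' (ENNReal.pow_ne_top (by simp))

/-- The `n`-th level is the single cylinder of length `n + 1`; the extra bit makes the bound `2⁻ⁿ`
strict. -/
theorem notMem_mlRandom_of_rePred {ξ : Seq}
    (h : REPred fun p : Str × ℕ => p.1 = initSeg ξ (p.2 + 1)) : ξ ∉ mlRandom cyl coin := by
  have hlev (n : ℕ) : level cyl {p : Str × ℕ | p.1 = initSeg ξ (p.2 + 1)} n =
      cyl (initSeg ξ (n + 1)) := by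
    ext ω
    simp [level]
  refine notMem_mlRandom_iff.2 ⟨{p | p.1 = initSeg ξ (p.2 + 1)}, ⟨h, fun n => ⟨?_, ?_⟩⟩, fun n => ?_⟩
  · rw [hlev, hlev]
    exact antitone_cyl_initSeg ξ (Nat.le_succ _)
  · rw [hlev, coin_cyl, length_initSeg]
    exact two_inv_pow_succ_lt n
  · rw [hlev]
    exact mem_cyl_initSeg _ _

theorem exists_eq_false_of_mlRandom {ξ : Seq} (hξ : ξ ∈ mlRandom cyl coin) (n : ℕ) :
    ∃ m, n ≤ m ∧ ξ m = false := by
  contrapose! hξ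
  refine notMem_mlRandom_of_rePred ?_
  -- A sequence that is eventually one has computable initial segments: pad a fixed string with ones
  -- and truncate.
  have hseg (m : ℕ) : initSeg ξ m = (initSeg ξ n ++ List.replicate m true).take m := by
    refine List.ext_getElem (by simp) fun i hi hi' => ?_
    rw [List.getElem_take, List.getElem_append]
    split_ifs with h
    · simp [initSeg]
    · simp only [length_initSeg, not_lt] at h
      simpa [initSeg] using hξ i h
  have hs : Primrec fun p : Str × ℕ => p.2 + 1 := Primrec.succ.comp Primrec.snd
  have heq : PrimrecPred fun p : Str × ℕ =>
      p.1 = (initSeg ξ n ++ List.replicate (p.2 + 1) true).take (p.2 + 1) :=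
    Primrec.eq.comp Primrec.fst (Primrec.list_take.comp hs
      (Primrec.list_append.comp (Primrec.const _) (primrec_replicate_true.comp hs)))
  exact (rePred_of_primrecPred heq).of_eq fun p => by rw [← hseg]

/-! ### The joint distribution -/

/-- The second coordinate as a function of the first: a run of ones as long as the value of the
initial segments of `ω` stays above the threshold `h`. -/
def thresh (h : ℕ → ℕ) (ω : Seq) : Seq := fun i => decide (h i ≤ strVal (initSeg ω i))

/-- The joint distribution of a uniformly distributed `ω` and `thresh h ω`. -/
noncomputable def joint (h : ℕ → ℕ) : Measure (Seq × Seq) := coin.map fun ω => (ω, thresh h ω)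

variable {h : ℕ → ℕ}

theorem thresh_apply_eq_true {ω : Seq} {i : ℕ} :
    thresh h ω i = true ↔ h i ≤ strVal (initSeg ω i) := by
  simp [thresh]

theorem measurable_thresh (h : ℕ → ℕ) : Measurable (thresh h) := by
  refine measurable_pi_lambda _ fun i => measurable_to_bool ?_
  have : (fun ω => thresh h ω i) ⁻¹' {true} = {ω | h i ≤ strVal (initSeg ω i)} := by
    ext ω; simp [thresh]
  rw [this]
  exact measurableSet_initSeg i fun x => h i ≤ strVal x

theorem measurable_graph (h : ℕ → ℕ) : Measurable fun ω => (ω, thresh h ω) :=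
  measurable_id.prodMk (measurable_thresh h)

instance : IsProbabilityMeasure (joint h) :=
  Measure.isProbabilityMeasure_map (measurable_graph h).aemeasurable

theorem joint_apply {A : Set (Seq × Seq)} (hA : MeasurableSet A) :
    joint h A = coin {ω | (ω, thresh h ω) ∈ A} :=
  Measure.map_apply (measurable_graph h) hA

theorem joint_fst : (joint h).fst = coin := by
  rw [joint, Measure.fst_map_prodMk (measurable_thresh h)]
  exact Measure.map_id

theorem joint_snd_apply {A : Set Seq} (hA : MeasurableSet A) :
    (joint h).snd A = coin (thresh h ⁻¹' A) := by
  rw [Measure.snd_apply hA, joint_apply (measurable_snd hA)]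
  rfl

theorem joint_snd_singleton (η : Seq) : (joint h).snd {η} = coin {ω | thresh h ω = η} :=
  joint_snd_apply (measurableSet_singleton η)

theorem condPoint_joint (η : Seq) {A : Set Seq} (hA : MeasurableSet A) :
    condPoint (joint h) η A =
      ((joint h).snd {η})⁻¹ * coin {ω | thresh h ω = η ∧ ω ∈ A} := by
  rw [condPoint_apply η hA, joint_apply ((measurable_snd (measurableSet_singleton η)).inter
    (measurable_fst hA))]
  rfl

/-- The string `z` extends `x`, and the values of `thresh h` computed from `z` extend `y`. -/
def Compat (h : ℕ → ℕ) (p : Str × Str) (z : Str) : Prop :=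
  z.take p.1.length = p.1 ∧
    ∀ i < p.2.length, p.2[i]? = some (decide (h i ≤ strVal (z.take i)))

theorem primrecRel_compat (hh : Primrec h) : PrimrecRel (Compat h) := by
  have hy : Primrec fun q : ℕ × (Str × Str) × Str => q.2.1.2 :=
    Primrec.snd.comp (Primrec.fst.comp Primrec.snd)
  have hz : Primrec fun q : ℕ × (Str × Str) × Str => q.2.2 := Primrec.snd.comp Primrec.snd
  have h1 : PrimrecPred fun q : ℕ × (Str × Str) × Str => h q.1 ≤ strVal (q.2.2.take q.1) :=
    Primrec.nat_le.comp (hh.comp Primrec.fst)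
      (primrec_strVal.comp (Primrec.list_take.comp Primrec.fst hz))
  have h2 : PrimrecRel fun (i : ℕ) (q : (Str × Str) × Str) =>
      q.1.2[i]? = some (decide (h i ≤ strVal (q.2.take i))) :=
    Primrec.eq.comp (Primrec.list_getElem?.comp hy Primrec.fst)
      (Primrec.option_some.comp h1.decide)
  have hx : Primrec fun q : (Str × Str) × Str => q.1.1 := Primrec.fst.comp Primrec.fst
  exact (Primrec.eq.comp (Primrec.list_take.comp (Primrec.list_length.comp hx) Primrec.snd)
    hx).and ((h2.forall_mem_list.comp (Primrec.list_range.comp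
      (Primrec.list_length.comp (Primrec.snd.comp Primrec.fst))) Primrec.id).of_eq
        fun q => by simp only [List.mem_range, id])

theorem compat_initSeg_iff {x y : Str} {n : ℕ} (hx : x.length ≤ n) (hy : y.length ≤ n)
    {ω : Seq} : Compat h (x, y) (initSeg ω n) ↔ ω ∈ cyl x ∧ thresh h ω ∈ cyl y := by
  rw [Compat, take_initSeg _ hx, mem_cyl_iff]
  refine and_congr_right fun _ => ?_
  refine forall_congr' fun i => forall_congr' fun hi => ?_
  rw [take_initSeg _ (hi.le.trans hy), List.getElem?_eq_getElem hi, Option.some_inj, eq_comm]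
  rfl

theorem joint_cyl₂ (p : Str × Str) [DecidablePred (Compat h p)] :
    joint h (cyl₂ p) =
      (((strings (p.1.length + p.2.length)).filter (Compat h p ·)).length : ℝ≥0∞) *
        (2⁻¹ : ℝ≥0∞) ^ (p.1.length + p.2.length) := by
  rw [← coin_initSeg, joint_apply (measurableSet_cyl₂ p)]
  congr 1
  ext ω
  exact (compat_initSeg_iff (Nat.le_add_right _ _) (Nat.le_add_left _ _)).symm

theorem isComputable_joint (hh : Primrec h) : IsComputable cyl₂ (joint h) := by
  classical
  have h1 : PrimrecRel fun (z : Str) (p : Str × Str) => Compat h p z :=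
    (primrecRel_compat hh).comp Primrec.snd Primrec.fst
  have hN : Primrec fun q : (Str × Str) × ℕ => q.1.1.length + q.1.2.length :=
    Primrec.nat_add.comp (Primrec.list_length.comp (Primrec.fst.comp Primrec.fst))
      (Primrec.list_length.comp (Primrec.snd.comp Primrec.fst))
  -- The probability is an exact dyadic rational, obtained by counting strings long enough to decide
  -- both cylinders. The `- 1` offsets the denominator `c + 1` in `IsComputable`.
  refine ⟨fun q => ((strings (q.1.1.length + q.1.2.length)).filter (Compat h q.1 ·)).length,
    fun _ => 0, fun q => 2 ^ (q.1.1.length + q.1.2.length) - 1, ?_, Computable.const 0, ?_, ?_⟩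
  · exact (Primrec.list_length.comp (h1.listFilter.comp (primrec_strings.comp hN)
      Primrec.fst)).to_comp
  · exact (Primrec.nat_sub.comp (primrec_two_pow hN) (Primrec.const 1)).to_comp
  · intro p k
    have h2 : (((2 ^ (p.1.length + p.2.length) - 1 : ℕ) : ℝ)) + 1 =
        2 ^ (p.1.length + p.2.length) := by
      rw [Nat.cast_sub Nat.one_le_two_pow]; simp
    rw [h2, measureReal_def, joint_cyl₂, ENNReal.toReal_mul, ENNReal.toReal_natCast,
      ENNReal.toReal_pow, ENNReal.toReal_inv, ENNReal.toReal_ofNat, Nat.cast_zero, sub_zero,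
      div_eq_mul_inv, inv_pow, sub_self, abs_zero]
    positivity

/-- The first coordinate determines the second, so the preimages of disjoint cylinders under `thresh
h` separate the two conditional laws. -/
theorem mutuallySingular_condStr_joint {y z : Str} (hyz : Disjoint (cyl y) (cyl z)) :
    (condStr (joint h) y).MutuallySingular (condStr (joint h) z) := by
  have hm : MeasurableSet (thresh h ⁻¹' cyl y) := measurable_thresh h (measurableSet_cyl y)
  have hcond (w : Str) {A : Set Seq} (hA : MeasurableSet A)
      (hd : ∀ ω ∈ A, thresh h ω ∉ cyl w) : condStr (joint h) w A = 0 := by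
    rw [condStr_apply w hA, joint_apply ((measurable_snd (measurableSet_cyl w)).inter
      (measurable_fst hA))]
    have : {ω | (ω, thresh h ω) ∈ Prod.snd ⁻¹' cyl w ∩ Prod.fst ⁻¹' A} = ∅ :=
      Set.eq_empty_of_forall_notMem fun ω hω => hd ω hω.2 hω.1
    rw [this, measure_empty, mul_zero]
  refine ⟨(thresh h ⁻¹' cyl y)ᶜ, hm.compl, hcond y hm.compl fun ω hω => hω, ?_⟩
  rw [compl_compl]
  exact hcond z hm fun ω hω hz => Set.disjoint_left.1 hyz hω hz

/-- `h n` is the numerical value of a string of length `n`; these strings increase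
lexicographically towards the sequence `ξ`. -/
structure ApproachesFromLeft (h : ℕ → ℕ) (ξ : Seq) : Prop where
  two_mul_le : ∀ s, 2 * h s ≤ h (s + 1)
  le : ∀ n, h n ≤ strVal (initSeg ξ n)
  exists_le : ∀ n, ∃ s, strVal (initSeg ξ n) * 2 ^ s ≤ h (n + s)

/-! ### The atom at `1^∞` and the behaviour of `ξ` under conditioning -/

namespace ApproachesFromLeft

variable {ξ : Seq}

theorem thresh_antitone (H : ApproachesFromLeft h ξ) (ω : Seq) {i j : ℕ} (hij : i ≤ j)
    (hj : thresh h ω j = true) : thresh h ω i = true := by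
  induction j, hij using Nat.le_induction with
  | base => exact hj
  | succ j _ ih =>
    refine ih ?_
    rw [thresh_apply_eq_true] at hj ⊢
    rw [strVal_initSeg_succ] at hj
    have := Bool.toNat_le (ω j)
    have := H.two_mul_le j
    omega

/-- The right side is enumerable when `h` is computable, whereas the left side refers to `ξ`. -/
theorem strVal_le_iff (H : ApproachesFromLeft h ξ) {ω : Seq} {n : ℕ} :
    strVal (initSeg ω n) ≤ strVal (initSeg ξ n) ↔
      ∃ s, strVal (initSeg ω n) * 2 ^ s ≤ h (n + s) := by
  constructor
  · intro hle
    obtain ⟨s, hs⟩ := H.exists_le n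
    exact ⟨s, (Nat.mul_le_mul_right _ hle).trans hs⟩
  · rintro ⟨s, hs⟩
    have h1 := (hs.trans (H.le _)).trans_lt (strVal_initSeg_add ξ n s).2
    exact Nat.lt_succ_iff.1 (lt_of_mul_lt_mul_right h1 (Nat.zero_le _))

theorem thresh_eq_ones_iff (H : ApproachesFromLeft h ξ) {ω : Seq} :
    thresh h ω = ones ↔ ∀ n, strVal (initSeg ξ n) ≤ strVal (initSeg ω n) := by
  constructor
  · intro hω n
    obtain ⟨s, hs⟩ := H.exists_le n
    have h1 : h (n + s) ≤ strVal (initSeg ω (n + s)) :=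
      thresh_apply_eq_true.1 (congrFun hω (n + s))
    have h2 := (hs.trans h1).trans_lt (strVal_initSeg_add ω n s).2
    exact Nat.lt_succ_iff.1 (lt_of_mul_lt_mul_right h2 (Nat.zero_le _))
  · exact fun hω => funext fun n => thresh_apply_eq_true.2 ((H.le n).trans (hω n))

/-- Turning a zero of `ξ` beyond position `n` into a one gives a whole cylinder that lies above `ξ`
and agrees with it up to `n`. -/
theorem coin_thresh_ones_cyl_pos (H : ApproachesFromLeft h ξ) (hξ : ξ ∈ mlRandom cyl coin)
    (n : ℕ) : 0 < coin {ω | thresh h ω = ones ∧ ω ∈ cyl (initSeg ξ n)} := by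
  obtain ⟨m, hnm, hm⟩ := exists_eq_false_of_mlRandom hξ n
  have hpos : 0 < coin (cyl (initSeg ξ m ++ [true])) := by
    rw [coin_cyl]; exact ENNReal.pow_pos (by simp) _
  refine hpos.trans_le (measure_mono fun ω hω => ?_)
  rw [mem_cyl_iff, List.length_append, length_initSeg, List.length_singleton,
    initSeg_succ] at hω
  obtain ⟨h1, h2⟩ := List.append_inj hω (by simp)
  have h2 : ω m = true := by simpa using h2
  refine ⟨H.thresh_eq_ones_iff.2 fun k => ?_,
    mem_cyl_initSeg_iff.2 (initSeg_eq_of_le hnm h1)⟩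
  rcases le_or_gt k m with hk | hk
  · rw [initSeg_eq_of_le hk h1]
  · obtain ⟨s, rfl⟩ := Nat.exists_eq_add_of_le (Nat.succ_le_of_lt hk)
    have h3 := (strVal_initSeg_add ω (m + 1) s).1
    have h4 := (strVal_initSeg_add ξ (m + 1) s).2
    rw [strVal_initSeg_succ, h1, h2] at h3
    rw [strVal_initSeg_succ, hm] at h4
    exact (h4.trans_le h3).le

theorem joint_snd_ones_pos (H : ApproachesFromLeft h ξ) (hξ : ξ ∈ mlRandom cyl coin) :
    0 < (joint h).snd {ones} := by
  rw [joint_snd_singleton]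
  exact (H.coin_thresh_ones_cyl_pos hξ 0).trans_le (measure_mono fun ω hω => hω.1)

/-- Values of `thresh h` never return from zero to one. If `η` does, some cylinder around it is
null. If `η` is ones followed by zeros forever, a cylinder around it has the same mass as `{η}`.
Either way a random `η` must be an atom. -/
theorem joint_snd_singleton_ne_zero (H : ApproachesFromLeft h ξ) (hξ : ξ ∈ mlRandom cyl coin)
    {η : Seq} (hη : η ∈ mlRandom cyl (joint h).snd) : (joint h).snd {η} ≠ 0 := by
  by_cases hones : η = ones
  · rw [hones]; exact (H.joint_snd_ones_pos hξ).ne'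
  obtain ⟨i, hi⟩ : ∃ i, η i = false := by
    by_contra hcon
    push Not at hcon
    exact hones (funext fun i => by simpa [ones] using hcon i)
  intro h0
  rw [joint_snd_singleton] at h0
  by_cases hj : ∃ j, i ≤ j ∧ η j = true
  · obtain ⟨j, hij, hj⟩ := hj
    refine notMem_mlRandom_of_null ?_ (mem_cyl_initSeg η (j + 1)) hη
    rw [joint_snd_apply (measurableSet_cyl _)]
    convert measure_empty (μ := coin)
    refine Set.eq_empty_of_forall_notMem fun ω hω => ?_
    have hω (k : ℕ) (hk : k < j + 1) : thresh h ω k = η k := by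
      have := hω k (by simpa using hk)
      simpa [initSeg] using this
    have h1 := H.thresh_antitone ω hij ((hω j (by omega)).trans hj)
    rw [hω i (by omega), hi] at h1
    exact absurd h1 (by simp)
  · push Not at hj
    refine notMem_mlRandom_of_null ?_ (mem_cyl_initSeg η (i + 1)) hη
    rw [joint_snd_apply (measurableSet_cyl _), ← h0]
    congr 1
    ext ω
    constructor
    · intro hω
      have hω (k : ℕ) (hk : k < i + 1) : thresh h ω k = η k := by
        have := hω k (by simpa using hk)
        simpa [initSeg] using this
      refine funext fun k => ?_
      rcases Nat.lt_or_ge k (i + 1) with hk | hk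
      · exact hω k hk
      · have h1 : η k = false := by simpa using hj k (by omega)
        rw [h1]
        by_contra hk'
        have h2 := H.thresh_antitone ω (by omega : i ≤ k) (by simpa using hk')
        rw [hω i (by omega), hi] at h2
        exact absurd h2 (by simp)
    · rintro rfl
      exact mem_cyl_initSeg _ _

theorem rePred_strVal_le (hh : Primrec h) :
    REPred fun p : Str × ℕ => ∃ s, strVal p.1 * 2 ^ s ≤ h (p.1.length + s) := by
  have hx : Primrec fun q : (Str × ℕ) × ℕ => q.1.1 := Primrec.fst.comp Primrec.fst
  have h1 : PrimrecPred fun q : (Str × ℕ) × ℕ =>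
      strVal q.1.1 * 2 ^ q.2 ≤ h (q.1.1.length + q.2) :=
    Primrec.nat_le.comp (Primrec.nat_mul.comp (primrec_strVal.comp hx)
      (primrec_two_pow Primrec.snd))
      (hh.comp (Primrec.nat_add.comp (Primrec.list_length.comp hx) Primrec.snd))
  exact rePred_exists (rePred_of_primrecPred h1)

theorem rePred_measure_pos {ν : Measure Seq} (hν : IsComputable cyl ν) :
    REPred fun p : Str × ℕ => 0 < ν.real (cyl p.1) := by
  obtain ⟨a, b, c, ha, hb, hc, habc⟩ := hν
  have hxk : Computable fun q : (Str × ℕ) × ℕ => (q.1.1, q.2) :=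
    ((Primrec.fst.comp Primrec.fst).pair Primrec.snd).to_comp
  have hk : Computable fun q : (Str × ℕ) × ℕ => q.2 + 1 :=
    (Primrec.succ.comp Primrec.snd).to_comp
  have hle : Computable₂ fun m n : ℕ => decide (m ≤ n) := Primrec.nat_le.decide.to_comp
  have hmul : Computable₂ fun m n : ℕ => m * n := Primrec.nat_mul.to_comp
  have hadd : Computable₂ fun m n : ℕ => m + n := Primrec.nat_add.to_comp
  have h1 : Computable fun q : (Str × ℕ) × ℕ =>
      decide (c (q.1.1, q.2) + 1 + b (q.1.1, q.2) * (q.2 + 1) ≤ a (q.1.1, q.2) * (q.2 + 1)) :=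
    hle.comp (hadd.comp (Computable.succ.comp (hc.comp hxk)) (hmul.comp (hb.comp hxk) hk))
      (hmul.comp (ha.comp hxk) hk)
  refine (rePred_of_computable h1).of_eq fun p => ?_
  have hiff (k : ℕ) : decide (c (p.1, k) + 1 + b (p.1, k) * (k + 1) ≤ a (p.1, k) * (k + 1)) =
      true ↔ 1 / ((k : ℝ) + 1) ≤ ((a (p.1, k) : ℝ) - b (p.1, k)) / ((c (p.1, k) : ℝ) + 1) := by
    rw [decide_eq_true_iff, div_le_div_iff₀ (by positivity) (by positivity), sub_mul, one_mul,
      le_sub_iff_add_le]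
    exact_mod_cast Iff.rfl
  simp only [hiff]
  constructor
  · rintro ⟨k, hk⟩
    have := (abs_lt.1 (habc p.1 k)).1
    linarith
  · intro hpos
    -- Half the mass pays for the approximation error and half for the threshold `1 / (k + 1)`.
    obtain ⟨k, hk⟩ := exists_nat_one_div_lt (half_pos hpos)
    have := (abs_lt.1 (habc p.1 k)).2
    exact ⟨k, by linarith⟩

/-- A string of given length is an initial segment of `ξ` iff it does not exceed `ξ` and has
positive conditional mass; computability would make both conditions enumerable. -/
theorem not_isComputable_condPoint (H : ApproachesFromLeft h ξ) (hh : Primrec h)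
    (hξ : ξ ∈ mlRandom cyl coin) : ¬ IsComputable cyl (condPoint (joint h) ones) := by
  intro hcomp
  have := (isCondAt_condPoint (H.joint_snd_ones_pos hξ).ne').1
  refine notMem_mlRandom_of_rePred ?_ hξ
  have hlen : PrimrecPred fun p : Str × ℕ => p.1.length = p.2 + 1 :=
    Primrec.eq.comp (Primrec.list_length.comp Primrec.fst) (Primrec.succ.comp Primrec.snd)
  refine (rePred_and (rePred_of_primrecPred hlen) (rePred_and (rePred_strVal_le hh)
    (rePred_measure_pos hcomp))).of_eq ?_
  rintro ⟨x, n⟩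
  have hpos (x : Str) : 0 < (condPoint (joint h) ones).real (cyl x) ↔
      0 < coin {ω | thresh h ω = ones ∧ ω ∈ cyl x} := by
    rw [measureReal_def, ENNReal.toReal_pos_iff, condPoint_joint _ (measurableSet_cyl x),
      CanonicallyOrderedAdd.mul_pos, ENNReal.inv_pos]
    constructor
    · exact fun h => h.1.2
    · refine fun h => ⟨⟨measure_ne_top _ _, h⟩, ?_⟩
      rw [← condPoint_joint _ (measurableSet_cyl x)]
      exact measure_lt_top _ _
  constructor
  · rintro ⟨hl, hle, hp⟩
    obtain ⟨ω, hω, hx⟩ := nonempty_of_measure_ne_zero ((hpos x).1 hp).ne'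
    simp only at hl hle
    rw [mem_cyl_iff, hl] at hx
    rw [← hx, length_initSeg] at hle
    change x = initSeg ξ (n + 1)
    rw [← hx]
    exact initSeg_eq_of_strVal_eq
      ((H.strVal_le_iff.2 hle).antisymm (H.thresh_eq_ones_iff.1 hω _))
  · intro hx
    change x = initSeg ξ (n + 1) at hx
    subst hx
    refine ⟨by simp, ?_, (hpos _).2 (H.coin_thresh_ones_cyl_pos hξ _)⟩
    simp only [length_initSeg]
    exact H.exists_le _

/-- Pulling a test for the joint law back along the graph of `thresh h` gives a uniform test with
levels of the same measure, and the graph sends `ξ` to `(ξ, 1^∞)`. -/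
theorem mem_randomSection_ones (H : ApproachesFromLeft h ξ) (hh : Primrec h)
    (hξ : ξ ∈ mlRandom cyl coin) : ξ ∈ randomSection (joint h) ones := by
  contrapose hξ
  obtain ⟨U, ⟨hre, hU⟩, htU⟩ := notMem_mlRandom_iff.1 hξ
  set V : Set (Str × ℕ) := {q | ∃ p : Str × Str, (p, q.2) ∈ U ∧
    (p.1.length ≤ q.1.length ∧ p.2.length ≤ q.1.length) ∧ Compat h p q.1} with hV
  have hlev (n : ℕ) : level cyl V n = {ω | (ω, thresh h ω) ∈ level cyl₂ U n} := by
    ext ω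
    constructor
    · rintro ⟨z, ⟨p, hpU, ⟨hx, hy⟩, hc⟩, hz⟩
      rw [mem_cyl_iff] at hz
      rw [← hz] at hc
      exact ⟨p, hpU, (compat_initSeg_iff hx hy).1 hc⟩
    · rintro ⟨p, hpU, hp⟩
      refine ⟨initSeg ω (max p.1.length p.2.length), ⟨p, hpU, ⟨?_, ?_⟩, ?_⟩, mem_cyl_initSeg _ _⟩
      · simp
      · simp
      · exact (compat_initSeg_iff (le_max_left _ _) (le_max_right _ _)).2 hp
  refine notMem_mlRandom_iff.2 ⟨V, ⟨?_, fun n => ⟨?_, ?_⟩⟩, fun n => ?_⟩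
  · have hz : Primrec fun q : (Str × ℕ) × (Str × Str) => q.1.1.length :=
      Primrec.list_length.comp (Primrec.fst.comp Primrec.fst)
    have h1 : PrimrecPred fun q : (Str × ℕ) × (Str × Str) =>
        (q.2.1.length ≤ q.1.1.length ∧ q.2.2.length ≤ q.1.1.length) ∧ Compat h q.2 q.1.1 :=
      ((Primrec.nat_le.comp (Primrec.list_length.comp (Primrec.fst.comp Primrec.snd)) hz).and
        (Primrec.nat_le.comp (Primrec.list_length.comp (Primrec.snd.comp Primrec.snd)) hz)).and
        ((primrecRel_compat hh).comp Primrec.snd (Primrec.fst.comp Primrec.fst))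
    refine rePred_exists (rePred_and (rePred_comp hre
      (f := fun q : (Str × ℕ) × (Str × Str) => (q.2, q.1.2)) ?_) (rePred_of_primrecPred h1))
    exact (Primrec.snd.pair (Primrec.snd.comp Primrec.fst)).to_comp
  · rw [hlev, hlev]
    exact fun ω hω => (hU n).1 hω
  · rw [hlev, ← joint_apply (measurableSet_level measurableSet_cyl₂ U n)]
    exact (hU n).2
  · rw [hlev]
    have : thresh h ξ = ones := H.thresh_eq_ones_iff.2 fun _ => le_rfl
    change (ξ, thresh h ξ) ∈ level cyl₂ U n
    rw [this]
    exact htU n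

theorem notMem_mlRandom_condPoint_ones (H : ApproachesFromLeft h ξ) (hh : Primrec h)
    (hξ : ξ ∈ mlRandom cyl coin) : ξ ∉ mlRandom cyl (condPoint (joint h) ones) := by
  obtain ⟨k, hk⟩ := ENNReal.exists_inv_two_pow_lt (H.joint_snd_ones_pos hξ).ne'
  -- The levels enumerate strings up to `ξ`; since the conditional law lives on `ω ≥ ξ`, only the
  -- cylinder of `ξ` itself carries mass. The `k` absorbs the normalization, the `1` gives
  -- strictness.
  set V : Set (Str × ℕ) := {p | p.1.length = p.2 + (k + 1) ∧
    ∃ s, strVal p.1 * 2 ^ s ≤ h (p.1.length + s)} with hV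
  have hlev (n : ℕ) : level cyl V n =
      {ω | strVal (initSeg ω (n + (k + 1))) ≤ strVal (initSeg ξ (n + (k + 1)))} := by
    ext ω
    constructor
    · rintro ⟨x, ⟨hl, hle⟩, hx⟩
      simp only at hl hle
      rw [mem_cyl_iff, hl] at hx
      rw [← hx, length_initSeg] at hle
      exact H.strVal_le_iff.2 hle
    · intro hω
      refine ⟨initSeg ω (n + (k + 1)), ⟨by simp, ?_⟩, mem_cyl_initSeg _ _⟩
      simp only [length_initSeg]
      exact H.strVal_le_iff.1 hω
  refine notMem_mlRandom_iff.2 ⟨V, ⟨?_, fun n => ⟨?_, ?_⟩⟩, fun n => ?_⟩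
  · have hlen : PrimrecPred fun p : Str × ℕ => p.1.length = p.2 + (k + 1) :=
      Primrec.eq.comp (Primrec.list_length.comp Primrec.fst)
        (Primrec.nat_add.comp Primrec.snd (Primrec.const _))
    exact rePred_and (rePred_of_primrecPred hlen) (rePred_strVal_le hh)
  · rw [hlev, hlev]
    exact fun ω hω => strVal_le_of_le (by omega) hω
  · rw [condPoint_joint _ (measurableSet_level measurableSet_cyl V n)]
    refine two_pow_mul_lt hk ?_
    calc coin {ω | thresh h ω = ones ∧ ω ∈ level cyl V n}
        ≤ coin (cyl (initSeg ξ (n + (k + 1)))) := by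
          refine measure_mono fun ω hω => ?_
          obtain ⟨h1, h2⟩ := hω
          rw [hlev] at h2
          exact mem_cyl_initSeg_iff.2 (initSeg_eq_of_strVal_eq
            (le_antisymm h2 (H.thresh_eq_ones_iff.1 h1 _)))
      _ < (2⁻¹ : ℝ≥0∞) ^ (n + k) := by
          rw [coin_cyl, length_initSeg]
          exact two_inv_pow_succ_lt (n + k)
  · rw [hlev]
    exact le_refl (strVal (initSeg ξ (n + (k + 1))))

/-- If `η i` is zero, then `ω` is below `h i` at length `i`, while `ξ` is not; so the cylinder of
`ξ` of length `i` is null given `η`. -/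
theorem notMem_mlRandom_condPoint (H : ApproachesFromLeft h ξ) (hh : Primrec h)
    (hξ : ξ ∈ mlRandom cyl coin) (η : Seq) : ξ ∉ mlRandom cyl (condPoint (joint h) η) := by
  by_cases hones : η = ones
  · rw [hones]; exact H.notMem_mlRandom_condPoint_ones hh hξ
  obtain ⟨i, hi⟩ : ∃ i, η i = false := by
    by_contra hcon
    push Not at hcon
    exact hones (funext fun i => by simpa [ones] using hcon i)
  refine notMem_mlRandom_of_null ?_ (mem_cyl_initSeg ξ i)
  rw [condPoint_joint _ (measurableSet_cyl _)]
  have : {ω | thresh h ω = η ∧ ω ∈ cyl (initSeg ξ i)} = ∅ := by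
    refine Set.eq_empty_of_forall_notMem ?_
    rintro ω ⟨rfl, hω⟩
    rw [mem_cyl_initSeg_iff] at hω
    have h1 : thresh h ω i = true := thresh_apply_eq_true.2 (by rw [hω]; exact H.le i)
    rw [hi] at h1
    exact absurd h1 (by simp)
  rw [this, measure_empty, mul_zero]

end ApproachesFromLeft

end MLCond

open MLCond
theorem theorem6 :
    ∃ P : Measure (Seq × Seq), IsProbabilityMeasure P ∧
      -- at every random parameter the conditional probability exists
      (∀ η ∈ mlRandom cyl P.snd, IsCondAt P η (condAt P η)) ∧
      -- (1)
      (IsComputable cyl₂ P ∧ ones ∈ mlRandom cyl P.snd) ∧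
      -- (2)
      ¬ IsComputable cyl (condAt P ones) ∧
      -- (3)
      (∀ y z : Str, Disjoint (cyl y) (cyl z) → (condStr P y).MutuallySingular (condStr P z)) ∧
      -- (4)
      mlRandom cyl (condAt P ones) ⊂ randomSection P ones ∧
      -- (5)
      (⋃ η ∈ mlRandom cyl P.snd, mlRandom cyl (condAt P η)) ⊂ mlRandom cyl P.fst ∧
      -- (6)
      ∃ ξ ∈ mlRandom cyl P.fst, ∀ η ∈ mlRandom cyl P.snd, ξ ∉ mlRandom cyl (condAt P η) := by
  obtain ⟨h, ξ, hh, h1, h2, h3, hξ⟩ := exists_leftCE_random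
  have H : ApproachesFromLeft h ξ := ⟨h1, h2, h3⟩
  have hatom {η : Seq} (hη : η ∈ mlRandom cyl (joint h).snd) : (joint h).snd {η} ≠ 0 :=
    H.joint_snd_singleton_ne_zero hξ hη
  have hcond {η : Seq} (hη : η ∈ mlRandom cyl (joint h).snd) :
      condAt (joint h) η = condPoint (joint h) η :=
    condAt_eq (isCondAt_condPoint (hatom hη))
  have hones : ones ∈ mlRandom cyl (joint h).snd :=
    mem_mlRandom_of_atom (H.joint_snd_ones_pos hξ).ne'
  have hξ' : ξ ∈ mlRandom cyl (joint h).fst := by rwa [joint_fst]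
  have h6 : ∀ η ∈ mlRandom cyl (joint h).snd, ξ ∉ mlRandom cyl (condAt (joint h) η) :=
    fun η hη => by rw [hcond hη]; exact H.notMem_mlRandom_condPoint hh hξ η
  refine ⟨joint h, inferInstance,
    fun η hη => isCondAt_condAt (isCondAt_condPoint (hatom hη)),
    ⟨isComputable_joint hh, hones⟩, ?_, fun y z => mutuallySingular_condStr_joint, ?_, ?_,
    ξ, hξ', h6⟩
  · rw [hcond hones]; exact H.not_isComputable_condPoint hh hξ
  · refine (Set.ssubset_iff_of_subset ?_).2 ⟨ξ, H.mem_randomSection_ones hh hξ, h6 _ hones⟩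
    rw [hcond hones]
    exact mlRandom_condPoint_ones_subset (hatom hones)
  · refine (Set.ssubset_iff_of_subset ?_).2 ⟨ξ, hξ', by simpa using h6⟩
    refine Set.iUnion₂_subset fun η hη => ?_
    rw [hcond hη]
    exact mlRandom_condPoint_subset (hatom hη)
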